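/- **Lemma 3.3.** Let $\Omega\subset\mathbb{R}^d$ be a bounded connected (nonempty) open set, let $\alpha>1$ and $\lambda\ge 0$. Let $\mathcal M_2(\Omega)$ be the set of positive Borel measures $\mu$ on $\Omega$ with $\int_\Omega d^2(x,\partial\Omega)\,d\mu(x)<\infty$. For $\mu,\nu\in\mathcal M_2(\Omega)$ let $$Wb_2^2(\mu,\nu):=\inf_\gamma\int_{\overline\Omega\times\overline\Omega}|x-y|^2\,d\gamma(x,y),$$ the infimum being over all positive measures $\gamma$ on $\overline\Omega\times\overline\Omega$ with $(\pi^1_\#\gamma)|_\Omega=\mu$ and $(\pi^2_\#\gamma)|_\Omega=\nu$. For $\mu\in\mathcal M_2(\Omega)$ let $$E(\mu):=\int_\Omega\Big(\frac{\rho^\alpha-\alpha\lambda^{\alpha-1}\rho}{\alpha-1}+\lambda^\alpha\Big)dx\in[0,\infty]\quad\text{if }\mu=\rho\,\mathcal L^d|_\Omega,\qquad E(\mu):=\infty\quad\text{otherwise},$$ and, if $E(\mu)<\infty$, let $$|\nabla E|(\mu):=\limsup_{\nu\to\mu}\frac{(E(\mu)-E(\nu))^+}{Wb_2(\mu,\nu)}\in[0,\infty],$$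 where $\nu\in\mathcal M_2(\Omega)\setminus\{\mu\}$ tends to $\mu$ with respect to $Wb_2$. Let $\mu=\rho\,\mathcal L^d|_\Omega\in\mathcal M_2(\Omega)$ with $E(\mu)<\infty$. If $|\nabla E|(\mu)<\infty$, then $\rho^\alpha\in W^{1,1}(\Omega)$ and $$\int_\Omega\frac{|\nabla\rho^\alpha|^2}{\rho}\,dx\le|\nabla E|^2(\mu),$$ where $\nabla\rho^\alpha$ is the weak gradient and the integrand is $0$ where $\rho=0$ and $\nabla\rho^\alpha=0$, and $+\infty$ where $\rho=0$ and $\nabla\rho^\alpha\ne 0$. -/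

import Mathlib

open MeasureTheory Filter Topology Set
open scoped ENNReal NNReal ContDiff

namespace PMEDirichlet

noncomputable section

/-- The set `M₂(Ω)` of positive Borel measures `μ` on `Ω` with `∫_Ω d²(x, ∂Ω) dμ(x) < ∞`.
A Borel measure on `Ω` is encoded as a Borel measure on `ℝᵈ` giving no mass to the complement
of `Ω`. -/
def M2 {d : ℕ} (Ω : Set (EuclideanSpace ℝ (Fin d))) :
    Set (Measure (EuclideanSpace ℝ (Fin d))) :=
  {μ | μ Ωᶜ = 0 ∧ ∫⁻ x in Ω, Metric.infEDist x (frontier Ω) ^ 2 ∂μ < ⊤}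

/-- `μ = ρ ℒᵈ|_Ω`, for a (Lebesgue measurable) density `ρ ≥ 0`. -/
def HasDensity {d : ℕ} (Ω : Set (EuclideanSpace ℝ (Fin d)))
    (μ : Measure (EuclideanSpace ℝ (Fin d))) (ρ : EuclideanSpace ℝ (Fin d) → ℝ≥0) : Prop :=
  AEMeasurable ρ (volume.restrict Ω) ∧
    μ = (volume.restrict Ω).withDensity (fun x => (ρ x : ℝ≥0∞))

/-- The energy density `U(s) = (s^α - α λ^(α-1) s) / (α - 1) + λ^α`. For `α > 1`, `lam ≥ 0` and
`s ≥ 0` it is nonnegative, by Young's inequality. -/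
def U (α lam s : ℝ) : ℝ :=
  (s ^ α - α * lam ^ (α - 1) * s) / (α - 1) + lam ^ α

/-- The energy `E(μ)`, equal to `∫_Ω U(ρ) dx` if `μ = ρ ℒᵈ|_Ω`, and to `∞` otherwise.
The density of `μ` is unique up to null sets, so the infimum is over at most one value; it is `∞`
when `μ` has no density. -/
def energy {d : ℕ} (Ω : Set (EuclideanSpace ℝ (Fin d))) (α lam : ℝ)
    (μ : Measure (EuclideanSpace ℝ (Fin d))) : ℝ≥0∞ :=
  ⨅ (ρ : EuclideanSpace ℝ (Fin d) → ℝ≥0) (_ : HasDensity Ω μ ρ),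
    ∫⁻ x in Ω, ENNReal.ofReal (U α lam (ρ x))

/-- Admissible couplings `ADM(μ, ν)`: positive measures `γ` on `closure Ω × closure Ω` whose
marginals, restricted to the open set `Ω`, are `μ` and `ν`. -/
def ADM {d : ℕ} (Ω : Set (EuclideanSpace ℝ (Fin d)))
    (μ ν : Measure (EuclideanSpace ℝ (Fin d))) :
    Set (Measure (EuclideanSpace ℝ (Fin d) × EuclideanSpace ℝ (Fin d))) :=
  {γ | γ (closure Ω ×ˢ closure Ω)ᶜ = 0 ∧
    (γ.map Prod.fst).restrict Ω = μ ∧ (γ.map Prod.snd).restrict Ω = ν}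

/-- The transport cost `∫ |x - y|² dγ(x, y)`. -/
def cost {d : ℕ} (γ : Measure (EuclideanSpace ℝ (Fin d) × EuclideanSpace ℝ (Fin d))) : ℝ≥0∞ :=
  ∫⁻ p, edist p.1 p.2 ^ 2 ∂γ

/-- The distance `Wb₂`, with `Wb₂²(μ, ν) = inf {cost γ | γ ∈ ADM(μ, ν)}`. -/
def Wb2 {d : ℕ} (Ω : Set (EuclideanSpace ℝ (Fin d)))
    (μ ν : Measure (EuclideanSpace ℝ (Fin d))) : ℝ≥0∞ :=
  (⨅ γ ∈ ADM Ω μ ν, cost γ) ^ (1 / 2 : ℝ)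

/-- The filter "`ν → μ` in `(M₂(Ω), Wb₂)`, `ν ≠ μ`". -/
def puncturedNhds {d : ℕ} (Ω : Set (EuclideanSpace ℝ (Fin d)))
    (μ : Measure (EuclideanSpace ℝ (Fin d))) :
    Filter (Measure (EuclideanSpace ℝ (Fin d))) :=
  comap (fun ν => Wb2 Ω μ ν) (𝓝 0) ⊓ 𝓟 {ν | ν ∈ M2 Ω ∧ ν ≠ μ}

/-- The slope `|∇E|(μ) = limsup_{ν → μ} (E(μ) - E(ν))⁺ / Wb₂(μ, ν)` at a measure `μ` of finite
energy. Subtraction in `[0, ∞]` is truncated at `0`, hence is the positive part. -/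
def energySlope {d : ℕ} (Ω : Set (EuclideanSpace ℝ (Fin d))) (α lam : ℝ)
    (μ : Measure (EuclideanSpace ℝ (Fin d))) : ℝ≥0∞ :=
  limsup (fun ν => (energy Ω α lam μ - energy Ω α lam ν) / Wb2 Ω μ ν) (puncturedNhds Ω μ)

/-- `g` is the weak gradient of `u` on `Ω`: both are locally integrable and
`∫_Ω u ∂ᵢφ dx = - ∫_Ω φ gᵢ dx` for every `φ ∈ C_c^∞(Ω)` and every `i`. -/
def HasWeakGradient {d : ℕ} (Ω : Set (EuclideanSpace ℝ (Fin d)))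
    (u : EuclideanSpace ℝ (Fin d) → ℝ)
    (g : EuclideanSpace ℝ (Fin d) → EuclideanSpace ℝ (Fin d)) : Prop :=
  LocallyIntegrableOn u Ω ∧ LocallyIntegrableOn g Ω ∧
    ∀ φ : EuclideanSpace ℝ (Fin d) → ℝ, ContDiff ℝ ∞ φ → HasCompactSupport φ → tsupport φ ⊆ Ω →
      ∀ i : Fin d, ∫ x in Ω, u x * fderiv ℝ φ x (EuclideanSpace.single i 1)
        = - ∫ x in Ω, φ x * g x i

/-- `u ∈ W^{1,1}(Ω)`. -/
def MemW11 {d : ℕ} (Ω : Set (EuclideanSpace ℝ (Fin d)))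
    (u : EuclideanSpace ℝ (Fin d) → ℝ) : Prop :=
  IntegrableOn u Ω ∧
    ∃ g : EuclideanSpace ℝ (Fin d) → EuclideanSpace ℝ (Fin d),
      HasWeakGradient Ω u g ∧ IntegrableOn g Ω

end

end PMEDirichlet

/-! The proof is an inner variation. For a smooth field `ξ` with compact support in `Ω` and small `t
> 0`, the map `Φ = id + tξ` is a homeomorphism preserving `Ω`. Moving `μ` along `Φ`, with no
exchange of mass with the boundary, costs at most `t ‖ξ‖` in `Wb2`, the norm being that of `L²(μ)`
(`Wb2_map_le`). The new density is `ρ / J` at the moved point, with `J = det (1 + t Dξ)`. In the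
energy, the term linear in `ρ` is unchanged because mass is conserved, and the constant term because
`Φ` maps `Ω` onto itself. Only `ρ^α J^(1-α) / (α-1)` varies, and since `J^(1-α) = 1 - (α-1) t div ξ
+ o(t)` uniformly, the energy drops by `t ∫ ρ^α div ξ + o(t)` (`ofReal_le_energy_sub_energy_map`).
Comparison with the slope gives `∫ ρ^α div ξ ≤ |∇E|(μ) ‖ξ‖` (`integral_rpow_mul_trace_le`). By Riesz
there is `w` in `L²(μ)`, of norm at most the slope, with `∫ ρ^α div ξ = ∫ w · ξ dμ`
(`exists_velocity`). Hence `∇ρ^α = -ρ w`, which is integrable because `μ` is finite, and `|∇ρ^α|² /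
ρ ≤ ρ |w|²`, whose integral is `‖w‖²`. -/

namespace PMEDirichlet

/-! ### Expansion of the determinant near the identity -/

/-- The trace of an endomorphism, as a continuous linear map. -/
noncomputable def traceCLM (E : Type*) [NormedAddCommGroup E] [NormedSpace ℝ E]
    [FiniteDimensional ℝ E] : (E →L[ℝ] E) →L[ℝ] ℝ :=
  LinearMap.toContinuousLinearMap (LinearMap.trace ℝ E ∘ₗ ContinuousLinearMap.coeLM ℝ)

theorem traceCLM_apply {E : Type*} [NormedAddCommGroup E] [NormedSpace ℝ E]
    [FiniteDimensional ℝ E] (B : E →L[ℝ] E) :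
    traceCLM E B = LinearMap.trace ℝ E (B : E →ₗ[ℝ] E) := rfl

/-- The determinant is polynomial in the matrix entries, hence differentiable. Its derivative is
then fixed by its values along lines, where `det (1 + tB) = 1 + t tr B + O(t²)`. -/
theorem hasFDerivAt_det_one_add {E : Type*} [NormedAddCommGroup E] [NormedSpace ℝ E]
    [FiniteDimensional ℝ E] :
    HasFDerivAt (fun B : E →L[ℝ] E => (1 + B).det) (traceCLM E) 0 := by
  classical
  let b := Module.finBasis ℝ E
  have hdet : ∀ B : E →L[ℝ] E, (1 + B).det
      = (1 + LinearMap.toMatrix b b (B : E →ₗ[ℝ] E)).det := by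
    intro B
    rw [ContinuousLinearMap.det, ← LinearMap.det_toMatrix b]
    congr 1
    rw [ContinuousLinearMap.toLinearMap_add, map_add]
    congr 1
    exact LinearMap.toMatrix_one b
  have hdiff : DifferentiableAt ℝ (fun B : E →L[ℝ] E => (1 + B).det) 0 := by
    simp_rw [hdet, Matrix.det_apply]
    have hentry : ∀ i j, DifferentiableAt ℝ
        (fun B : E →L[ℝ] E => (1 + LinearMap.toMatrix b b (B : E →ₗ[ℝ] E)) i j) 0 := by
      intro i j
      let l : (E →L[ℝ] E) →ₗ[ℝ] ℝ :=
        Matrix.entryLinearMap ℝ ℝ i j ∘ₗ (LinearMap.toMatrix b b).toLinearMap ∘ₗ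
          ContinuousLinearMap.coeLM ℝ
      have : (fun B : E →L[ℝ] E => (1 + LinearMap.toMatrix b b (B : E →ₗ[ℝ] E)) i j)
          = fun B => (1 : Matrix _ _ ℝ) i j + LinearMap.toContinuousLinearMap l B := rfl
      rw [this]
      exact (LinearMap.toContinuousLinearMap l).differentiableAt.const_add _
    refine DifferentiableAt.fun_sum fun σ _ => ?_
    refine DifferentiableAt.const_smul ?_ _
    exact (HasFDerivAt.finsetProd (u := Finset.univ)
      fun i _ => (hentry (σ i) i).hasFDerivAt).differentiableAt
  have hline : ∀ B : E →L[ℝ] E,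
      HasDerivAt (fun t : ℝ => (1 + t • B).det) (traceCLM E B) 0 := by
    intro B
    have h1 : ∀ t : ℝ, (1 + t • B).det = 1 + traceCLM E B * t
        + (1 + (Polynomial.X : Polynomial ℝ) •
            (LinearMap.toMatrix b b (B : E →ₗ[ℝ] E)).map Polynomial.C).det.divX.divX.eval t
          * t ^ 2 := by
      intro t
      rw [hdet, ContinuousLinearMap.toLinearMap_smul, map_smul, Matrix.det_one_add_smul,
        traceCLM_apply, LinearMap.trace_eq_matrix_trace ℝ b]
    rw [funext h1]
    have h2 := ((1 + (Polynomial.X : Polynomial ℝ) •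
            (LinearMap.toMatrix b b (B : E →ₗ[ℝ] E)).map Polynomial.C).det.divX.divX.hasDerivAt
              (0 : ℝ)).mul (hasDerivAt_pow 2 (0 : ℝ))
    have h3 := (((hasDerivAt_id (0 : ℝ)).const_mul (traceCLM E B)).const_add 1).add h2
    refine (h3.congr_deriv (by simp)).congr_of_eventuallyEq (Eventually.of_forall fun t => ?_)
    simp
  have key : fderiv ℝ (fun B : E →L[ℝ] E => (1 + B).det) 0 = traceCLM E := by
    ext B
    have h4 : HasDerivAt (fun t : ℝ => t • B) B 0 := by
      simpa using (hasDerivAt_id (0 : ℝ)).smul_const B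
    have h5 : HasFDerivAt (fun B : E →L[ℝ] E => (1 + B).det)
        (fderiv ℝ (fun B : E →L[ℝ] E => (1 + B).det) 0) ((0 : ℝ) • B) := by
      rw [zero_smul]; exact hdiff.hasFDerivAt
    have h6 := h5.comp_hasDerivAt 0 h4
    exact h6.unique (hline B)
  rw [← key]
  exact hdiff.hasFDerivAt

/-- Uniform first order expansion of a power of the determinant near the identity. -/
theorem exists_det_rpow_expansion {E : Type*} [NormedAddCommGroup E] [NormedSpace ℝ E]
    [FiniteDimensional ℝ E] (β : ℝ) {ε : ℝ} (hε : 0 < ε) :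
    ∃ δ > 0, ∀ B : E →L[ℝ] E, ‖B‖ ≤ δ →
      0 < (1 + B).det ∧ |(1 + B).det ^ β - 1 - β * traceCLM E B| ≤ ε * ‖B‖ := by
  have h0 : ((1 : E →L[ℝ] E) + 0).det = 1 := by
    rw [add_zero]; exact LinearMap.det_id
  have hd := hasFDerivAt_det_one_add (E := E)
  have hpos : ∀ᶠ B : E →L[ℝ] E in 𝓝 0, 0 < (1 + B).det := by
    have := hd.continuousAt.eventually (p := fun r : ℝ => 0 < r)
    exact this (by simpa only [h0] using lt_mem_nhds one_pos)
  have hr := hd.rpow_const (p := β) (Or.inl (by rw [h0]; exact one_ne_zero))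
  have hexp := (hasFDerivAt_iff_isLittleO_nhds_zero.1 hr).def hε
  obtain ⟨δ, hδ, h⟩ := Metric.eventually_nhds_iff.1 (hpos.and hexp)
  refine ⟨δ / 2, half_pos hδ, fun B hB => ?_⟩
  obtain ⟨h1, h2⟩ := h (y := B) (by rw [dist_zero_right]; linarith)
  refine ⟨h1, ?_⟩
  simpa only [zero_add, h0, Real.one_rpow, mul_one, _root_.smul_apply, smul_eq_mul,
    Real.norm_eq_abs] using h2

/-! ### Riesz representation through a linear map -/

/-- A linear functional dominated by the Hilbert seminorm of a linear map is represented by a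
vector. -/
theorem exists_inner_eq_of_le_norm {V H : Type*} [AddCommGroup V] [Module ℝ V]
    [NormedAddCommGroup H] [InnerProductSpace ℝ H] [CompleteSpace H]
    (T : V →ₗ[ℝ] H) (l : V →ₗ[ℝ] ℝ) {S : ℝ} (hS : 0 ≤ S) (h : ∀ v, l v ≤ S * ‖T v‖) :
    ∃ w : H, ‖w‖ ≤ S ∧ ∀ v, l v = inner ℝ w (T v) := by
  have habs : ∀ v, |l v| ≤ S * ‖T v‖ := fun v =>
    abs_le'.2 ⟨h v, by simpa using h (-v)⟩
  obtain ⟨s, hs⟩ := T.rangeRestrict.exists_rightInverse_of_surjective T.range_rangeRestrict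
  have hTs : ∀ y, T (s y) = y := fun y =>
    congrArg Subtype.val (LinearMap.congr_fun hs y)
  let f := (l ∘ₗ s).mkContinuous S fun y => by
    have := habs (s y)
    rw [hTs] at this
    exact this
  obtain ⟨g, hg, hgn⟩ := exists_extension_norm_eq _ f
  refine ⟨(InnerProductSpace.toDual ℝ H).symm g, ?_, fun v => ?_⟩
  · rw [LinearIsometryEquiv.norm_map, hgn]
    exact LinearMap.mkContinuous_norm_le _ hS _
  · rw [InnerProductSpace.toDual_symm_apply]
    have h1 := hg ⟨T v, LinearMap.mem_range_self T v⟩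
    have h2 : f ⟨T v, LinearMap.mem_range_self T v⟩ = l (s ⟨T v, LinearMap.mem_range_self T v⟩) :=
      rfl
    -- `T` kills this difference, so the bound forces `l` to vanish on it: `l` factors through `T`,
    -- whatever section `s` was chosen.
    have h3 := habs (v - s ⟨T v, LinearMap.mem_range_self T v⟩)
    rw [map_sub T, hTs, sub_self, norm_zero, mul_zero] at h3
    have h4 := abs_nonpos_iff.1 h3
    rw [map_sub, sub_eq_zero] at h4
    rw [h4, ← h2, ← h1]

/-! ### The energy density -/

theorem U_nonneg {α lam s : ℝ} (hα : 1 < α) (hlam : 0 ≤ lam) (hs : 0 ≤ s) : 0 ≤ U α lam s := by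
  have hα0 : 0 < α - 1 := by linarith
  have hpq : α.HolderConjugate (α / (α - 1)) := Real.HolderConjugate.conjExponent hα
  have h := Real.young_inequality_of_nonneg hs (Real.rpow_nonneg hlam (α - 1)) hpq
  rw [← Real.rpow_mul hlam, mul_div_cancel₀ _ hα0.ne'] at h
  unfold U
  rw [div_add' _ _ _ hα0.ne']
  apply div_nonneg _ hα0.le
  have h2 : α * (s * lam ^ (α - 1)) ≤ α * (s ^ α / α + lam ^ α / (α / (α - 1))) :=
    mul_le_mul_of_nonneg_left h (by linarith)
  have h3 : α * (s ^ α / α + lam ^ α / (α / (α - 1))) = s ^ α + lam ^ α * (α - 1) := by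
    field_simp
  nlinarith

/-- Since `α > 1`, the linear term `c s` is at most `s^α / 2` beyond the threshold `M` with `M^(α-1)
= 2c`, and at most `c M` below it. This turns finite energy into integrability of `ρ^α` on a bounded
set. -/
theorem exists_rpow_le_U {α lam : ℝ} (hα : 1 < α) (hlam : 0 ≤ lam) :
    ∃ C, ∀ s, 0 ≤ s → s ^ α ≤ 2 * (α - 1) * U α lam s + C := by
  have hα0 : 0 < α - 1 := by linarith
  set c := α * lam ^ (α - 1) with hc
  have hc0 : 0 ≤ c := mul_nonneg (by linarith) (Real.rpow_nonneg hlam _)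
  set M := (2 * c) ^ (1 / (α - 1)) with hM
  have hM0 : 0 ≤ M := Real.rpow_nonneg (by linarith) _
  have hMα : M ^ (α - 1) = 2 * c := by
    rw [hM, ← Real.rpow_mul (by linarith), one_div_mul_cancel hα0.ne', Real.rpow_one]
  refine ⟨2 * (c * M), fun s hs => ?_⟩
  have key : c * s ≤ s ^ α / 2 + c * M := by
    rcases le_total s M with h | h
    · have := mul_le_mul_of_nonneg_left h hc0
      have := Real.rpow_nonneg hs α
      linarith
    · have h1 : 2 * c ≤ s ^ (α - 1) := hMα ▸ Real.rpow_le_rpow hM0 h hα0.le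
      have h2 : s ^ α = s ^ (α - 1) * s := by
        rw [← Real.rpow_add_one' hs (by linarith)]; congr 1; ring
      have h3 := mul_le_mul_of_nonneg_right h1 hs
      have := mul_nonneg hc0 hM0
      rw [h2]; linarith
  have hU : (α - 1) * U α lam s = s ^ α - c * s + (α - 1) * lam ^ α := by
    unfold U; rw [hc]; field_simp
  have := mul_nonneg hα0.le (Real.rpow_nonneg hlam α)
  linarith [hU]

theorem continuous_U {α lam : ℝ} (hα : 1 < α) : Continuous (U α lam) := by
  unfold U
  have := Real.continuous_rpow_const (q := α) (by linarith)
  fun_prop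

theorem energy_eq {d : ℕ} {Ω : Set (EuclideanSpace ℝ (Fin d))} {α lam : ℝ}
    {μ : Measure (EuclideanSpace ℝ (Fin d))} {ρ : EuclideanSpace ℝ (Fin d) → ℝ≥0}
    (hρ : HasDensity Ω μ ρ) :
    energy Ω α lam μ = ∫⁻ x in Ω, ENNReal.ofReal (U α lam (ρ x)) := by
  refine le_antisymm (iInf₂_le ρ hρ) (le_iInf₂ fun ρ' hρ' => le_of_eq ?_)
  have h := hρ.2.symm.trans hρ'.2
  have h2 := (withDensity_eq_iff_of_sigmaFinite hρ.1.coe_nnreal_ennreal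
    hρ'.1.coe_nnreal_ennreal).1 h
  refine lintegral_congr_ae ?_
  filter_upwards [h2] with x hx
  rw [ENNReal.coe_inj.1 hx]

/-! ### Perturbations of the identity -/

/-- A perturbation of the identity by a contraction supported in `Ω` is a homeomorphism of the
whole space that maps `Ω` onto itself. -/
theorem exists_homeomorph_add {E : Type*} [NormedAddCommGroup E] [NormedSpace ℝ E]
    [CompleteSpace E] {Ω : Set E} {ζ : E → E} (hζ : Differentiable ℝ ζ)
    (hsupp : tsupport ζ ⊆ Ω) {r : ℝ≥0} (hr : r < 1) (hbound : ∀ x, ‖fderiv ℝ ζ x‖₊ ≤ r) :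
    ∃ Φ : E ≃ₜ E, (∀ x, Φ x = x + ζ x) ∧ ∀ x, Φ x ∈ Ω ↔ x ∈ Ω := by
  have hlip : LipschitzWith r ζ := lipschitzWith_of_nnnorm_fderiv_le hζ hbound
  have happ : ApproximatesLinearOn (fun x => x + ζ x)
      ((ContinuousLinearEquiv.refl ℝ E : E ≃L[ℝ] E) : E →L[ℝ] E) univ r := by
    refine LipschitzOnWith.approximatesLinearOn ?_
    have : (fun x => x + ζ x) - ⇑((ContinuousLinearEquiv.refl ℝ E : E ≃L[ℝ] E) : E →L[ℝ] E) = ζ := by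
      ext x; simp
    rw [this]
    exact hlip.lipschitzOnWith
  -- In dimension zero the identity has norm `0`, so that case is separate.
  have hc : Subsingleton E ∨
      r < ‖((ContinuousLinearEquiv.refl ℝ E).symm : E →L[ℝ] E)‖₊⁻¹ := by
    rcases subsingleton_or_nontrivial E with h | h
    · exact Or.inl h
    · right
      have : ‖((ContinuousLinearEquiv.refl ℝ E).symm : E →L[ℝ] E)‖₊ = 1 := by
        ext
        exact ContinuousLinearMap.norm_id
      rw [this, inv_one]
      exact hr
  let Φ := happ.toHomeomorph _ hc
  have hΦ : ∀ x, Φ x = x + ζ x := fun x => rfl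
  -- Points outside `Ω` are fixed, so by injectivity no point can cross the boundary in either
  -- direction.
  have hfix : ∀ x, x ∉ Ω → Φ x = x := fun x hx => by
    rw [hΦ, image_eq_zero_of_notMem_tsupport fun h => hx (hsupp h), add_zero]
  refine ⟨Φ, hΦ, fun x => ⟨fun h => ?_, fun h => ?_⟩⟩
  · by_contra hx
    exact hx (hfix x hx ▸ h)
  · by_contra hx
    exact hx ((Φ.injective (hfix _ hx)).symm ▸ h)

theorem hasFDerivAt_homeomorph_add {E : Type*} [NormedAddCommGroup E] [NormedSpace ℝ E]
    {ζ : E → E} (hζ : Differentiable ℝ ζ) {Φ : E ≃ₜ E} (hΦ : ∀ x, Φ x = x + ζ x) (x : E) :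
    HasFDerivAt Φ (1 + fderiv ℝ ζ x) x := by
  rw [show (Φ : E → E) = fun x => x + ζ x from funext hΦ]
  exact (hasFDerivAt_id x).add (hζ x).hasFDerivAt

/-! ### Density, energy, cost and moment of the push-forward -/

section Pushforward

variable {d : ℕ} {Ω : Set (EuclideanSpace ℝ (Fin d))}
  {ζ : EuclideanSpace ℝ (Fin d) → EuclideanSpace ℝ (Fin d)}
  {Φ : EuclideanSpace ℝ (Fin d) ≃ₜ EuclideanSpace ℝ (Fin d)}
  {μ : Measure (EuclideanSpace ℝ (Fin d))} {ρ : EuclideanSpace ℝ (Fin d) → ℝ≥0}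

theorem continuous_det_one_add_fderiv (hζ : ContDiff ℝ ∞ ζ) :
    Continuous fun x => (1 + fderiv ℝ ζ x).det :=
  ContinuousLinearMap.continuous_det.comp
    (continuous_const.add (hζ.continuous_fderiv (by simp)))

theorem lintegral_comp_homeomorph (hΩ : MeasurableSet Ω) (hζ : Differentiable ℝ ζ)
    (hΦ : ∀ x, Φ x = x + ζ x) (hΦΩ : ∀ x, Φ x ∈ Ω ↔ x ∈ Ω)
    (hJ : ∀ x, 0 < (1 + fderiv ℝ ζ x).det) {A : Set (EuclideanSpace ℝ (Fin d))}
    (hA : MeasurableSet A) (g : EuclideanSpace ℝ (Fin d) → ℝ≥0∞) :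
    ∫⁻ y in A ∩ Ω, g y =
      ∫⁻ x in Φ ⁻¹' A ∩ Ω, ENNReal.ofReal (1 + fderiv ℝ ζ x).det * g (Φ x) := by
  have himage : Φ '' (Φ ⁻¹' A ∩ Ω) = A ∩ Ω := by
    have h : Φ ⁻¹' A ∩ Ω = Φ ⁻¹' (A ∩ Ω) := by
      ext x; simp [hΦΩ]
    rw [h, image_preimage_eq _ Φ.surjective]
  rw [← himage, lintegral_image_eq_lintegral_abs_det_fderiv_mul volume
    ((Φ.continuous.measurable hA).inter hΩ)
    (fun x _ => (hasFDerivAt_homeomorph_add hζ hΦ x).hasFDerivWithinAt) Φ.injective.injOn]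
  simp_rw [abs_of_pos (hJ _)]

/-- The density of the push-forward of `ρ ℒᵈ|_Ω` under the diffeomorphism `x ↦ x + ζ x`. -/
theorem hasDensity_map (hΩ : MeasurableSet Ω) (hζ : ContDiff ℝ ∞ ζ)
    (hΦ : ∀ x, Φ x = x + ζ x) (hΦΩ : ∀ x, Φ x ∈ Ω ↔ x ∈ Ω)
    (hJ : ∀ x, 0 < (1 + fderiv ℝ ζ x).det) (hρm : Measurable ρ) (hρ : HasDensity Ω μ ρ) :
    HasDensity Ω (μ.map Φ)
      fun y => ρ (Φ.symm y) / ((1 + fderiv ℝ ζ (Φ.symm y)).det).toNNReal := by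
  have hJm := (continuous_det_one_add_fderiv hζ).measurable.real_toNNReal
  refine ⟨?_, ?_⟩
  · exact ((hρm.div hJm).comp Φ.symm.continuous.measurable).aemeasurable
  · ext A hA
    rw [Measure.map_apply Φ.continuous.measurable hA, hρ.2,
      withDensity_apply _ (Φ.continuous.measurable hA), withDensity_apply _ hA,
      Measure.restrict_restrict hA, Measure.restrict_restrict (Φ.continuous.measurable hA),
      lintegral_comp_homeomorph hΩ (hζ.differentiable (by simp)) hΦ hΦΩ hJ hA]
    refine lintegral_congr fun x => ?_
    beta_reduce
    rw [Φ.symm_apply_apply, ENNReal.ofReal, ← ENNReal.coe_mul, mul_div_cancel₀]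
    exact (Real.toNNReal_pos.2 (hJ x)).ne'

theorem energy_map_le {α lam : ℝ} (hΩ : MeasurableSet Ω) (hζ : ContDiff ℝ ∞ ζ)
    (hΦ : ∀ x, Φ x = x + ζ x) (hΦΩ : ∀ x, Φ x ∈ Ω ↔ x ∈ Ω)
    (hJ : ∀ x, 0 < (1 + fderiv ℝ ζ x).det) (hρm : Measurable ρ) (hρ : HasDensity Ω μ ρ) :
    energy Ω α lam (μ.map Φ) ≤ ∫⁻ x in Ω, ENNReal.ofReal
      ((1 + fderiv ℝ ζ x).det * U α lam (ρ x / (1 + fderiv ℝ ζ x).det)) := by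
  rw [energy_eq (hasDensity_map hΩ hζ hΦ hΦΩ hJ hρm hρ)]
  have h := lintegral_comp_homeomorph hΩ (hζ.differentiable (by simp)) hΦ hΦΩ hJ
    MeasurableSet.univ
    fun y => ENNReal.ofReal (U α lam
      ((ρ (Φ.symm y) / ((1 + fderiv ℝ ζ (Φ.symm y)).det).toNNReal : ℝ≥0) : ℝ))
  simp only [univ_inter, preimage_univ] at h
  rw [h]
  refine le_of_eq (lintegral_congr fun x => ?_)
  rw [Φ.symm_apply_apply, ENNReal.ofReal_mul (hJ x).le, NNReal.coe_div,
    Real.coe_toNNReal _ (hJ x).le]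

/-- `Φ` maps `Ω` onto itself, so it preserves the total volume. This removes the `lam ^ α` term from
the energy difference. -/
theorem setIntegral_det_eq (hΩ : MeasurableSet Ω) (hζ : ContDiff ℝ ∞ ζ)
    (hΦ : ∀ x, Φ x = x + ζ x) (hΦΩ : ∀ x, Φ x ∈ Ω ↔ x ∈ Ω)
    (hJ : ∀ x, 0 < (1 + fderiv ℝ ζ x).det) :
    ∫ x in Ω, (1 + fderiv ℝ ζ x).det = ∫ _ in Ω, (1 : ℝ) := by
  have himage : Φ '' Ω = Ω := by
    have h : Ω = Φ ⁻¹' Ω := by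
      ext x; simp [hΦΩ]
    nth_rw 1 [h]
    exact image_preimage_eq _ Φ.surjective
  have h := integral_image_eq_integral_abs_det_fderiv_smul volume hΩ
    (fun x _ => (hasFDerivAt_homeomorph_add (hζ.differentiable (by simp)) hΦ
      x).hasFDerivWithinAt) Φ.injective.injOn fun _ => (1 : ℝ)
  rw [himage] at h
  rw [h]
  simp_rw [abs_of_pos (hJ _), smul_eq_mul, mul_one]

/-- The coupling `(id, Φ)_# μ` is admissible because `Φ` preserves `Ω`, and its cost is `∫ |ζ|² dμ`.
-/
theorem Wb2_map_le (hΩ : MeasurableSet Ω) (hΦ : ∀ x, Φ x = x + ζ x)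
    (hΦΩ : ∀ x, Φ x ∈ Ω ↔ x ∈ Ω) (hμ : μ Ωᶜ = 0) :
    Wb2 Ω μ (μ.map Φ) ≤ eLpNorm ζ 2 μ := by
  have hmeas : Measurable fun x => (x, Φ x) :=
    measurable_id.prodMk Φ.continuous.measurable
  have hmem : ∀ᵐ x ∂μ, x ∈ Ω := hμ
  have hadm : μ.map (fun x => (x, Φ x)) ∈ ADM Ω μ (μ.map Φ) := by
    refine ⟨?_, ?_, ?_⟩
    · rw [Measure.map_apply hmeas
        (isClosed_closure.measurableSet.prod isClosed_closure.measurableSet).compl]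
      exact measure_mono_null (fun x hx hxΩ =>
        hx ⟨subset_closure hxΩ, subset_closure ((hΦΩ x).2 hxΩ)⟩) hμ
    · rw [Measure.map_map measurable_fst hmeas]
      have : Prod.fst ∘ (fun x => (x, Φ x)) = id := rfl
      rw [this, Measure.map_id]
      exact Measure.restrict_eq_self_of_ae_mem hmem
    · rw [Measure.map_map measurable_snd hmeas]
      have : Prod.snd ∘ (fun x => (x, Φ x)) = Φ := rfl
      rw [this]
      refine Measure.restrict_eq_self_of_ae_mem ?_
      refine (ae_map_iff Φ.continuous.aemeasurable hΩ).2 ?_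
      filter_upwards [hmem] with x hx using (hΦΩ x).2 hx
  have hcost : cost (μ.map fun x => (x, Φ x)) = ∫⁻ x, ‖ζ x‖ₑ ^ 2 ∂μ := by
    rw [cost, lintegral_map (by fun_prop) hmeas]
    refine lintegral_congr fun x => ?_
    rw [hΦ, edist_eq_enorm_sub]
    simp
  rw [Wb2, eLpNorm_eq_lintegral_rpow_enorm_toReal two_ne_zero ENNReal.ofNat_ne_top]
  simp only [ENNReal.toReal_ofNat, ENNReal.rpow_ofNat]
  rw [← hcost]
  exact ENNReal.rpow_le_rpow (iInf₂_le _ hadm) (by norm_num)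

theorem map_mem_M2 (hΩ : MeasurableSet Ω) (hζ : Continuous ζ) (hΦ : ∀ x, Φ x = x + ζ x)
    (hΦΩ : ∀ x, Φ x ∈ Ω ↔ x ∈ Ω) (hμ : μ ∈ M2 Ω) (hζμ : MemLp ζ 2 μ) :
    μ.map Φ ∈ M2 Ω := by
  have hpre : ∀ x, x ∈ Φ ⁻¹' Ω ↔ x ∈ Ω := hΦΩ
  refine ⟨?_, ?_⟩
  · rw [Measure.map_apply Φ.continuous.measurable hΩ.compl, preimage_compl,
      show Φ ⁻¹' Ω = Ω from Set.ext hpre]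
    exact hμ.1
  · rw [setLIntegral_map hΩ (by fun_prop) Φ.continuous.measurable,
      show Φ ⁻¹' Ω = Ω from Set.ext hpre]
    -- The distance to the boundary grows by at most `|ζ x|`; then `(a + b)² ≤ 4 (a² + b²)`, a crude
    -- constant being enough for finiteness.
    have hpt : ∀ x, Metric.infEDist (Φ x) (frontier Ω) ^ 2
        ≤ 4 * (Metric.infEDist x (frontier Ω) ^ 2 + ‖ζ x‖ₑ ^ 2) := by
      intro x
      have h1 : Metric.infEDist (Φ x) (frontier Ω)
          ≤ Metric.infEDist x (frontier Ω) + ‖ζ x‖ₑ := by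
        refine (Metric.infEDist_le_infEDist_add_edist (y := x)).trans_eq ?_
        rw [edist_eq_enorm_sub, hΦ, add_sub_cancel_left]
      refine (pow_le_pow_left' h1 2).trans ?_
      generalize Metric.infEDist x (frontier Ω) = a
      generalize ‖ζ x‖ₑ = b
      have h4 : (4 : ℝ≥0∞) = 2 ^ 2 := by norm_num
      rcases le_total a b with h | h
      · calc (a + b) ^ 2 ≤ (2 * b) ^ 2 := by rw [two_mul]; gcongr
          _ = 4 * b ^ 2 := by rw [mul_pow, h4]
          _ ≤ _ := by gcongr; exact le_add_self
      · calc (a + b) ^ 2 ≤ (2 * a) ^ 2 := by rw [two_mul]; gcongr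
          _ = 4 * a ^ 2 := by rw [mul_pow, h4]
          _ ≤ _ := by gcongr; exact le_self_add
    have hfin : ∫⁻ x, ‖ζ x‖ₑ ^ 2 ∂μ < ⊤ := by
      simpa using lintegral_rpow_enorm_lt_top_of_eLpNorm_lt_top two_ne_zero
        ENNReal.ofNat_ne_top hζμ.2
    refine (lintegral_mono hpt).trans_lt ?_
    rw [lintegral_const_mul _ (by fun_prop), lintegral_add_left (by fun_prop)]
    refine ENNReal.mul_lt_top ENNReal.ofNat_lt_top (ENNReal.add_lt_top.2 ⟨hμ.2, ?_⟩)
    exact (setLIntegral_le_lintegral _ _).trans_lt hfin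

end Pushforward

/-! ### The slope inequality and the first variation of the energy -/

/-- Below the slope, the energy decreases at most linearly in the distance. -/
theorem exists_energy_sub_le {d : ℕ} {Ω : Set (EuclideanSpace ℝ (Fin d))} {α lam : ℝ}
    {μ : Measure (EuclideanSpace ℝ (Fin d))} {S : ℝ≥0∞} (hS : energySlope Ω α lam μ < S)
    (hStop : S ≠ ⊤) :
    ∃ η > 0, ∀ ν ∈ M2 Ω, Wb2 Ω μ ν < η →
      energy Ω α lam μ - energy Ω α lam ν ≤ S * Wb2 Ω μ ν := by
  have h := eventually_lt_of_limsup_lt hS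
  rw [puncturedNhds, eventually_inf_principal, eventually_comap] at h
  obtain ⟨η, hη, h⟩ := ENNReal.nhds_zero_basis.eventually_iff.1 h
  refine ⟨η, hη, fun ν hν hW => ?_⟩
  -- The punctured filter says nothing about `ν = μ`, where the inequality is trivial.
  by_cases hνμ : ν = μ
  · rw [hνμ, tsub_self]; exact zero_le
  · exact (ENNReal.div_le_iff_le_mul (Or.inr hStop) (Or.inr (pos_of_gt hS).ne')).1
      (h hW ν rfl ⟨hν, hνμ⟩).le

section FirstVariation

variable {d : ℕ} {Ω : Set (EuclideanSpace ℝ (Fin d))} {α lam : ℝ}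
  {μ : Measure (EuclideanSpace ℝ (Fin d))} {ρ : EuclideanSpace ℝ (Fin d) → ℝ≥0}

theorem integrableOn_U (hα : 1 < α) (hlam : 0 ≤ lam) (hρ : HasDensity Ω μ ρ)
    (hE : energy Ω α lam μ < ⊤) : IntegrableOn (fun x => U α lam (ρ x)) Ω := by
  rw [energy_eq hρ] at hE
  refine ⟨((continuous_U hα).measurable.comp_aemeasurable
    hρ.1.coe_nnreal_real).aestronglyMeasurable, ?_⟩
  rw [hasFiniteIntegral_iff_ofReal (Eventually.of_forall fun x => U_nonneg hα hlam (ρ x).coe_nonneg)]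
  exact hE

theorem integrableOn_rpow (hΩb : Bornology.IsBounded Ω) (hα : 1 < α) (hlam : 0 ≤ lam)
    (hρ : HasDensity Ω μ ρ) (hE : energy Ω α lam μ < ⊤) :
    IntegrableOn (fun x => (ρ x : ℝ) ^ α) Ω := by
  obtain ⟨C, hC⟩ := exists_rpow_le_U hα hlam
  have hfin : IsFiniteMeasure (volume.restrict Ω) := ⟨by simpa using hΩb.measure_lt_top⟩
  refine Integrable.mono'
    (((integrableOn_U hα hlam hρ hE).const_mul (2 * (α - 1))).add (integrable_const C))
    (hρ.1.coe_nnreal_real.pow_const α).aestronglyMeasurable (Eventually.of_forall fun x => ?_)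
  rw [Real.norm_of_nonneg (Real.rpow_nonneg (ρ x).coe_nonneg α)]
  exact hC _ (ρ x).coe_nonneg

theorem integrableOn_density (hΩb : Bornology.IsBounded Ω) (hα : 1 < α) (hlam : 0 ≤ lam)
    (hρ : HasDensity Ω μ ρ) (hE : energy Ω α lam μ < ⊤) :
    IntegrableOn (fun x => (ρ x : ℝ)) Ω := by
  have hfin : IsFiniteMeasure (volume.restrict Ω) := ⟨by simpa using hΩb.measure_lt_top⟩
  refine Integrable.mono'
    ((integrableOn_rpow hΩb hα hlam hρ hE).add (integrable_const 1))
    hρ.1.coe_nnreal_real.aestronglyMeasurable (Eventually.of_forall fun x => ?_)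
  rw [Real.norm_of_nonneg (ρ x).coe_nonneg, Pi.add_apply]
  rcases le_total (ρ x : ℝ) 1 with h | h
  · have := Real.rpow_nonneg (ρ x).coe_nonneg α
    linarith
  · have := Real.rpow_le_rpow_of_exponent_le h hα.le
    rw [Real.rpow_one] at this
    linarith

theorem isFiniteMeasure_of_energy (hΩb : Bornology.IsBounded Ω) (hα : 1 < α) (hlam : 0 ≤ lam)
    (hρ : HasDensity Ω μ ρ) (hE : energy Ω α lam μ < ⊤) : IsFiniteMeasure μ := by
  have h := (integrableOn_density hΩb hα hlam hρ hE).2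
  rw [hasFiniteIntegral_iff_ofReal (Eventually.of_forall fun x => (ρ x).coe_nonneg)] at h
  refine ⟨?_⟩
  rw [hρ.2, withDensity_apply _ MeasurableSet.univ, Measure.restrict_univ]
  simpa using h

/-- Pulled back to the original domain, the term linear in `s` no longer sees `J`. The Jacobian
enters only through `J ^ (1 - α)` and the volume term. -/
theorem mul_U_div {s J : ℝ} (hα : 1 < α) (hs : 0 ≤ s) (hJ : 0 < J) :
    J * U α lam (s / J) = (s ^ α * J ^ (1 - α) - α * lam ^ (α - 1) * s) / (α - 1)
      + lam ^ α * J := by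
  have h : J ^ (1 - α) = J / J ^ α := by rw [Real.rpow_sub hJ, Real.rpow_one]
  have hJα : J ^ α ≠ 0 := (Real.rpow_pos_of_pos hJ α).ne'
  have hα0 : α - 1 ≠ 0 := by linarith
  unfold U
  rw [Real.div_rpow hs hJ.le, h]
  field_simp

/-- The integrands differ by `ρ^α (1 - J^(1-α)) / (α-1) + lam^α (1 - J)`. The second term integrates
to zero, and `hκ` bounds the first from below by `ρ^α (div ζ - κ)`; the factor `α - 1` in `hκ`
cancels the denominator. -/
theorem ofReal_le_energy_sub_energy_map
    {ζ : EuclideanSpace ℝ (Fin d) → EuclideanSpace ℝ (Fin d)}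
    {Φ : EuclideanSpace ℝ (Fin d) ≃ₜ EuclideanSpace ℝ (Fin d)}
    (hΩ : MeasurableSet Ω) (hΩb : Bornology.IsBounded Ω) (hα : 1 < α) (hlam : 0 ≤ lam)
    (hζ : ContDiff ℝ ∞ ζ)
    (hΦ : ∀ x, Φ x = x + ζ x) (hΦΩ : ∀ x, Φ x ∈ Ω ↔ x ∈ Ω)
    (hJ : ∀ x, 0 < (1 + fderiv ℝ ζ x).det) {κ : ℝ}
    (hκ : ∀ x, |(1 + fderiv ℝ ζ x).det ^ (1 - α) - 1 - (1 - α) * traceCLM _ (fderiv ℝ ζ x)|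
      ≤ (α - 1) * κ)
    (hρm : Measurable ρ) (hρ : HasDensity Ω μ ρ) (hE : energy Ω α lam μ < ⊤) :
    ENNReal.ofReal (∫ x in Ω, (ρ x : ℝ) ^ α * (traceCLM _ (fderiv ℝ ζ x) - κ)) ≤
      energy Ω α lam μ - energy Ω α lam (μ.map Φ) := by
  have hα0 : 0 < α - 1 := by linarith
  have hfin : IsFiniteMeasure (volume.restrict Ω) := ⟨by simpa using hΩb.measure_lt_top⟩
  have hIU := integrableOn_U hα hlam hρ hE
  have hIα := integrableOn_rpow hΩb hα hlam hρ hE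
  have hIρ := integrableOn_density hΩb hα hlam hρ hE
  have hJc := continuous_det_one_add_fderiv hζ
  have hTc : Continuous fun x => traceCLM _ (fderiv ℝ ζ x) :=
    (traceCLM _).continuous.comp (hζ.continuous_fderiv (by simp))
  have hbdd : ∀ {f : EuclideanSpace ℝ (Fin d) → ℝ}, Continuous f →
      ∃ C, ∀ᵐ x ∂volume.restrict Ω, ‖f x‖ ≤ C := fun {f} hf => by
    obtain ⟨C, hC⟩ := hΩb.isCompact_closure.exists_bound_of_continuousOn hf.continuousOn
    exact ⟨C, (ae_restrict_mem hΩ).mono fun x hx => hC x (subset_closure hx)⟩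
  have hmul : ∀ {f : EuclideanSpace ℝ (Fin d) → ℝ}, Continuous f →
      IntegrableOn (fun x => (ρ x : ℝ) ^ α * f x) Ω := fun {f} hf => by
    obtain ⟨C, hC⟩ := hbdd hf
    exact hIα.mul_bdd hf.aestronglyMeasurable hC
  have hIJ : IntegrableOn (fun x => (1 + fderiv ℝ ζ x).det) Ω := by
    obtain ⟨C, hC⟩ := hbdd hJc
    exact Integrable.of_bound hJc.aestronglyMeasurable C hC
  have hIV : IntegrableOn (fun x => (1 + fderiv ℝ ζ x).det *
      U α lam (ρ x / (1 + fderiv ℝ ζ x).det)) Ω := by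
    have hrw := fun x => mul_U_div (lam := lam) hα (ρ x).coe_nonneg (hJ x)
    simp only [IntegrableOn, hrw]
    exact (((hmul (hJc.rpow_const fun x => Or.inl (hJ x).ne')).sub
      (hIρ.const_mul _)).div_const _).add (hIJ.const_mul _)
  have ha : energy Ω α lam μ = ENNReal.ofReal (∫ x in Ω, U α lam (ρ x)) := by
    rw [energy_eq hρ, ofReal_integral_eq_lintegral_ofReal hIU
      (Eventually.of_forall fun x => U_nonneg hα hlam (ρ x).coe_nonneg)]
  have hVnn : ∀ x, 0 ≤ (1 + fderiv ℝ ζ x).det * U α lam (ρ x / (1 + fderiv ℝ ζ x).det) :=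
    fun x => mul_nonneg (hJ x).le (U_nonneg hα hlam (div_nonneg (ρ x).coe_nonneg (hJ x).le))
  have hb : energy Ω α lam (μ.map Φ) ≤ ENNReal.ofReal (∫ x in Ω,
      (1 + fderiv ℝ ζ x).det * U α lam (ρ x / (1 + fderiv ℝ ζ x).det)) := by
    rw [ofReal_integral_eq_lintegral_ofReal hIV (Eventually.of_forall hVnn)]
    exact energy_map_le hΩ hζ hΦ hΦΩ hJ hρm hρ
  refine le_trans ?_ (tsub_le_tsub_left hb _)
  rw [ha, ← ENNReal.ofReal_sub _ (integral_nonneg hVnn)]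
  refine ENNReal.ofReal_le_ofReal ?_
  have hJ0 : ∫ x in Ω, lam ^ α * (1 - (1 + fderiv ℝ ζ x).det) = 0 := by
    rw [integral_const_mul, integral_sub (integrable_const _) hIJ,
      setIntegral_det_eq hΩ hζ hΦ hΦΩ hJ, sub_self, mul_zero]
  have hIJ' : IntegrableOn (fun x => lam ^ α * (1 - (1 + fderiv ℝ ζ x).det)) Ω :=
    ((integrable_const _).sub hIJ).const_mul _
  have hIT : IntegrableOn (fun x => (ρ x : ℝ) ^ α * (traceCLM _ (fderiv ℝ ζ x) - κ)) Ω :=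
    hmul (hTc.sub (continuous_const (y := κ)))
  rw [← integral_sub hIU hIV]
  calc ∫ x in Ω, (ρ x : ℝ) ^ α * (traceCLM _ (fderiv ℝ ζ x) - κ)
      = ∫ x in Ω, ((ρ x : ℝ) ^ α * (traceCLM _ (fderiv ℝ ζ x) - κ)
          + lam ^ α * (1 - (1 + fderiv ℝ ζ x).det)) := by
        rw [integral_add hIT hIJ', hJ0, add_zero]
    _ ≤ _ := by
        refine integral_mono (hIT.add hIJ') (hIU.sub hIV) fun x => ?_
        beta_reduce
        rw [mul_U_div hα (ρ x).coe_nonneg (hJ x)]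
        have h1 := (abs_le.1 (hκ x)).2
        have h2 : traceCLM _ (fderiv ℝ ζ x) - κ ≤
            (1 - (1 + fderiv ℝ ζ x).det ^ (1 - α)) / (α - 1) := by
          rw [le_div_iff₀ hα0]; linarith
        have h3 := mul_le_mul_of_nonneg_left h2 (Real.rpow_nonneg (ρ x).coe_nonneg α)
        unfold U
        refine (add_le_add_left h3 _).trans_eq ?_
        ring

/-- The first variation of the energy along a test vector field is controlled by the slope. -/
theorem integral_rpow_mul_trace_le
    {ξ : EuclideanSpace ℝ (Fin d) → EuclideanSpace ℝ (Fin d)}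
    (hΩ : MeasurableSet Ω) (hΩb : Bornology.IsBounded Ω) (hα : 1 < α) (hlam : 0 ≤ lam)
    (hξ : ContDiff ℝ ∞ ξ) (hξc : HasCompactSupport ξ) (hξΩ : tsupport ξ ⊆ Ω)
    (hμ : μ ∈ M2 Ω) (hρm : Measurable ρ) (hρ : HasDensity Ω μ ρ)
    (hE : energy Ω α lam μ < ⊤) (hslope : energySlope Ω α lam μ < ⊤) :
    ∫ x in Ω, (ρ x : ℝ) ^ α * traceCLM _ (fderiv ℝ ξ x)
      ≤ (energySlope Ω α lam μ).toReal * (eLpNorm ξ 2 μ).toReal := by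
  have hα0 : 0 < α - 1 := by linarith
  have hfinμ := isFiniteMeasure_of_energy hΩb hα hlam hρ hE
  have hIα := integrableOn_rpow hΩb hα hlam hρ hE
  have hDc : Continuous (fderiv ℝ ξ) := hξ.continuous_fderiv (by simp)
  have hLp : MemLp ξ 2 μ := hξ.continuous.memLp_of_hasCompactSupport hξc
  obtain ⟨R, hR⟩ := (hξc.fderiv ℝ).exists_bound_of_continuous hDc
  have hR0 : 0 ≤ R := (norm_nonneg _).trans (hR 0)
  have hTc : Continuous fun x => traceCLM _ (fderiv ℝ ξ x) := (traceCLM _).continuous.comp hDc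
  have hIT : IntegrableOn (fun x => (ρ x : ℝ) ^ α * traceCLM _ (fderiv ℝ ξ x)) Ω := by
    obtain ⟨C, hC⟩ := hΩb.isCompact_closure.exists_bound_of_continuousOn hTc.continuousOn
    exact hIα.mul_bdd hTc.aestronglyMeasurable
      ((ae_restrict_mem hΩ).mono fun x hx => hC x (subset_closure hx))
  set P := ∫ x in Ω, (ρ x : ℝ) ^ α with hP
  have hP0 : 0 ≤ P := integral_nonneg fun x => Real.rpow_nonneg (ρ x).coe_nonneg α
  set N := (eLpNorm ξ 2 μ).toReal with hN
  have hN0 : 0 ≤ N := ENNReal.toReal_nonneg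
  set S := (energySlope Ω α lam μ).toReal with hS
  have hS0 : 0 ≤ S := ENNReal.toReal_nonneg
  -- One `ε` serves both as the excess over the slope and as the relative error in the determinant
  -- expansion; it tends to zero at the end.
  have key : ∀ ε > 0, ∫ x in Ω, (ρ x : ℝ) ^ α * traceCLM _ (fderiv ℝ ξ x)
      ≤ (S + ε) * N + ε * R * P := by
    intro ε hε
    obtain ⟨δ, hδ, hdet⟩ := exists_det_rpow_expansion (E := EuclideanSpace ℝ (Fin d)) (1 - α)
      (mul_pos hα0 hε)
    have hSε : energySlope Ω α lam μ < ENNReal.ofReal (S + ε) :=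
      (ENNReal.lt_ofReal_iff_toReal_lt hslope.ne).2 (by linarith)
    obtain ⟨η, hη, hdec⟩ := exists_energy_sub_le hSε ENNReal.ofReal_ne_top
    -- `t R < 1` makes `t ξ` a contraction, `t R < δ` validates the expansion, and the last
    -- condition places the push-forward where the slope inequality holds.
    have hsmall : ∀ᶠ t : ℝ in 𝓝[>] 0, 0 < t ∧ t * R < min δ 1 ∧ ENNReal.ofReal (t * N) < η := by
      have hlim : ∀ c : ℝ, Tendsto (fun t : ℝ => t * c) (𝓝[>] 0) (𝓝 0) := fun c => by
        have := (continuous_mul_const c).tendsto (0 : ℝ)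
        rw [zero_mul] at this
        exact this.mono_left nhdsWithin_le_nhds
      refine (eventually_mem_nhdsWithin).and
        (((hlim R).eventually_lt_const (lt_min hδ one_pos)).and ?_)
      have := ENNReal.tendsto_ofReal (hlim N)
      rw [ENNReal.ofReal_zero] at this
      exact this.eventually_lt_const hη
    obtain ⟨t, ht, htR, htN⟩ := hsmall.exists
    have hfd : ∀ x, fderiv ℝ (t • ξ) x = t • fderiv ℝ ξ x := fun x =>
      fderiv_const_smul (hξ.differentiable (by simp) x) t
    have hnorm : ∀ x, ‖fderiv ℝ (t • ξ) x‖ ≤ t * R := fun x => by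
      rw [hfd, norm_smul, Real.norm_of_nonneg ht.le]
      exact mul_le_mul_of_nonneg_left (hR x) ht.le
    have hζ : ContDiff ℝ ∞ (t • ξ) := contDiff_const.smul hξ
    obtain ⟨Φ, hΦ, hΦΩ⟩ := exists_homeomorph_add (Ω := Ω) (ζ := t • ξ)
      (r := ⟨t * R, mul_nonneg ht.le hR0⟩) (hζ.differentiable (by simp))
      ((tsupport_smul_subset_right (fun _ => t) ξ).trans hξΩ)
      (NNReal.coe_lt_coe.1 (htR.trans_le (min_le_right _ _))) hnorm
    have hdet' := fun x => hdet (fderiv ℝ (t • ξ) x)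
      ((hnorm x).trans (htR.le.trans (min_le_left _ _)))
    have hlow := ofReal_le_energy_sub_energy_map (lam := lam) (κ := ε * (t * R)) hΩ hΩb hα hlam hζ
      hΦ hΦΩ (fun x => (hdet' x).1) (fun x => (hdet' x).2.trans (by
        rw [mul_assoc]
        have := hnorm x
        gcongr)) hρm hρ hE
    have hW := Wb2_map_le hΩ hΦ hΦΩ hμ.1
    have hnormLp : eLpNorm (t • ξ) 2 μ = ENNReal.ofReal (t * N) := by
      rw [eLpNorm_const_smul, ENNReal.ofReal_mul ht.le, hN, ENNReal.ofReal_toReal hLp.2.ne,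
        Real.enorm_of_nonneg ht.le]
    rw [hnormLp] at hW
    have hup := hdec _ (map_mem_M2 hΩ hζ.continuous hΦ hΦΩ hμ (hLp.const_smul t))
      (hW.trans_lt htN)
    have h1 := (hlow.trans hup).trans (mul_le_mul_right hW _)
    rw [← ENNReal.ofReal_mul (by linarith),
      ENNReal.ofReal_le_ofReal_iff (by positivity)] at h1
    -- Both sides are proportional to `t`, so a single small `t` suffices and is divided out.
    have h2 : ∫ x in Ω, (ρ x : ℝ) ^ α * (traceCLM _ (fderiv ℝ (t • ξ) x) - ε * (t * R))
        = t * ((∫ x in Ω, (ρ x : ℝ) ^ α * traceCLM _ (fderiv ℝ ξ x)) - ε * R * P) := by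
      rw [hP, ← integral_const_mul (ε * R), ← integral_sub hIT (hIα.const_mul _),
        ← integral_const_mul]
      refine integral_congr_ae (Eventually.of_forall fun x => ?_)
      beta_reduce
      rw [hfd, map_smul, smul_eq_mul]
      ring
    rw [h2] at h1
    have h3 : t * ((∫ x in Ω, (ρ x : ℝ) ^ α * traceCLM _ (fderiv ℝ ξ x)) - ε * R * P)
        ≤ t * ((S + ε) * N) := by linarith
    linarith [le_of_mul_le_mul_left h3 ht]
  refine le_of_forall_pos_le_add fun ε hε => ?_
  -- The added `1` keeps the divisor positive when `N` and `R * P` vanish.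
  have hpos : 0 < N + R * P + 1 := by positivity
  have h := key (ε / (N + R * P + 1)) (div_pos hε hpos)
  have h2 : ε / (N + R * P + 1) * (N + R * P) ≤ ε := by
    rw [div_mul_eq_mul_div, div_le_iff₀ hpos]
    nlinarith
  nlinarith

end FirstVariation

/-! ### Test fields, Riesz representation and the weak gradient -/

/-- Smooth vector fields with compact support in `Ω`. -/
def testFields {d : ℕ} (Ω : Set (EuclideanSpace ℝ (Fin d))) :
    Submodule ℝ (EuclideanSpace ℝ (Fin d) → EuclideanSpace ℝ (Fin d)) where
  carrier := {ξ | ContDiff ℝ ∞ ξ ∧ HasCompactSupport ξ ∧ tsupport ξ ⊆ Ω}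
  add_mem' := fun hξ hζ => ⟨hξ.1.add hζ.1, hξ.2.1.add hζ.2.1,
    (tsupport_add _ _).trans (union_subset hξ.2.2 hζ.2.2)⟩
  zero_mem' := ⟨contDiff_const, HasCompactSupport.zero, by simp [tsupport]⟩
  smul_mem' := fun t ξ hξ => ⟨contDiff_const.smul hξ.1, hξ.2.1.smul_left,
    (tsupport_smul_subset_right (fun _ => t) ξ).trans hξ.2.2⟩

theorem traceCLM_smulRight {E : Type*} [NormedAddCommGroup E] [NormedSpace ℝ E]
    [FiniteDimensional ℝ E] (f : E →L[ℝ] ℝ) (v : E) : traceCLM E (f.smulRight v) = f v :=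
  LinearMap.trace_smulRight (f : E →ₗ[ℝ] ℝ) v

section WeakGradient

variable {d : ℕ} {Ω : Set (EuclideanSpace ℝ (Fin d))}

/-- The fundamental lemma of the calculus of variations, applied to each coordinate of `g - h`. It
transfers the final estimate from the gradient constructed here to an arbitrary one. -/
theorem HasWeakGradient.ae_eq {u : EuclideanSpace ℝ (Fin d) → ℝ}
    {g h : EuclideanSpace ℝ (Fin d) → EuclideanSpace ℝ (Fin d)} (hΩ : IsOpen Ω)
    (hg : HasWeakGradient Ω u g) (hh : HasWeakGradient Ω u h) :
    g =ᵐ[volume.restrict Ω] h := by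
  have hcoord : ∀ i, ∀ᵐ x ∂volume.restrict Ω, g x i = h x i := by
    intro i
    have hgi : LocallyIntegrableOn (fun x => g x i) Ω :=
      (EuclideanSpace.proj (𝕜 := ℝ) i).locallyIntegrableOn_comp hg.2.1
    have hhi : LocallyIntegrableOn (fun x => h x i) Ω :=
      (EuclideanSpace.proj (𝕜 := ℝ) i).locallyIntegrableOn_comp hh.2.1
    have h0 := hΩ.ae_eq_zero_of_integral_contDiff_smul_eq_zero (hgi.sub hhi)
      fun φ hφ hφc hφΩ => by
        have hint : ∀ {f : EuclideanSpace ℝ (Fin d) → ℝ}, LocallyIntegrableOn f Ω →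
            IntegrableOn (fun x => φ x * f x) Ω := fun {f} hf => by
          have h1 : IntegrableOn (fun x => φ x * f x) (tsupport φ) :=
            (hf.integrableOn_compact_subset hφΩ hφc).continuousOn_mul hφ.continuous.continuousOn
              hφc
          refine (integrableOn_iff_integrable_of_support_subset ?_).1 h1 |>.integrableOn
          exact (Function.support_mul_subset_left _ _).trans (subset_tsupport φ)
        rw [← setIntegral_eq_integral_of_forall_compl_eq_zero (s := Ω) fun x hx => by
          rw [image_eq_zero_of_notMem_tsupport fun hx' => hx (hφΩ hx'), zero_smul]]
        simp_rw [Pi.sub_apply, smul_eq_mul, mul_sub]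
        rw [integral_sub (hint hgi) (hint hhi), sub_eq_zero, ← neg_inj,
          ← hg.2.2 φ hφ hφc hφΩ i, hh.2.2 φ hφ hφc hφΩ i]
    rw [← ae_restrict_iff' hΩ.measurableSet] at h0
    filter_upwards [h0] with x hx using sub_eq_zero.1 hx
  filter_upwards [ae_all_iff.2 hcoord] with x hx
  ext i
  exact hx i

variable {α lam : ℝ} {μ : Measure (EuclideanSpace ℝ (Fin d))}
  {ρ : EuclideanSpace ℝ (Fin d) → ℝ≥0}

/-- Riesz representation of the first variation of the energy in `L²(μ)`. -/
theorem exists_velocity (hΩ : IsOpen Ω) (hΩb : Bornology.IsBounded Ω) (hα : 1 < α)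
    (hlam : 0 ≤ lam) (hμ : μ ∈ M2 Ω) (hρ : HasDensity Ω μ ρ)
    (hE : energy Ω α lam μ < ⊤) (hslope : energySlope Ω α lam μ < ⊤) :
    ∃ w : Lp (EuclideanSpace ℝ (Fin d)) 2 μ, ‖w‖ ≤ (energySlope Ω α lam μ).toReal ∧
      ∀ ξ ∈ testFields Ω, ∫ x in Ω, (ρ x : ℝ) ^ α * traceCLM _ (fderiv ℝ ξ x)
        = ∫ x, inner ℝ (w x) (ξ x) ∂μ := by
  have hfinμ := isFiniteMeasure_of_energy hΩb hα hlam hρ hE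
  have hIα := integrableOn_rpow hΩb hα hlam hρ hE
  have hLp : ∀ ξ : testFields Ω, MemLp ξ.1 2 μ := fun ξ =>
    ξ.2.1.continuous.memLp_of_hasCompactSupport ξ.2.2.1
  have hint : ∀ ξ : testFields Ω,
      IntegrableOn (fun x => (ρ x : ℝ) ^ α * traceCLM _ (fderiv ℝ ξ x)) Ω := fun ξ => by
    have hTc : Continuous fun x => traceCLM _ (fderiv ℝ ξ.1 x) :=
      (traceCLM _).continuous.comp (ξ.2.1.continuous_fderiv (by simp))
    obtain ⟨C, hC⟩ := hΩb.isCompact_closure.exists_bound_of_continuousOn hTc.continuousOn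
    exact hIα.mul_bdd hTc.aestronglyMeasurable
      ((ae_restrict_mem hΩ.measurableSet).mono fun x hx => hC x (subset_closure hx))
  let T : testFields Ω →ₗ[ℝ] Lp (EuclideanSpace ℝ (Fin d)) 2 μ :=
    { toFun := fun ξ => (hLp ξ).toLp _
      map_add' := fun ξ ζ => (hLp ξ).toLp_add (hLp ζ)
      map_smul' := fun t ξ => (hLp ξ).toLp_const_smul t }
  let l : testFields Ω →ₗ[ℝ] ℝ :=
    { toFun := fun ξ => ∫ x in Ω, (ρ x : ℝ) ^ α * traceCLM _ (fderiv ℝ ξ x)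
      map_add' := fun ξ ζ => by
        rw [← integral_add (hint ξ) (hint ζ)]
        refine integral_congr_ae (Eventually.of_forall fun x => ?_)
        beta_reduce
        rw [Submodule.coe_add, fderiv_add (ξ.2.1.differentiable (by simp) x)
          (ζ.2.1.differentiable (by simp) x), map_add, mul_add]
      map_smul' := fun t ξ => by
        rw [RingHom.id_apply, smul_eq_mul, ← integral_const_mul]
        refine integral_congr_ae (Eventually.of_forall fun x => ?_)
        beta_reduce
        rw [Submodule.coe_smul, fderiv_const_smul (ξ.2.1.differentiable (by simp) x), map_smul,
          smul_eq_mul, mul_left_comm] }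
  -- The push-forward formulas ask for a Borel density; a measurable representative changes neither
  -- `μ` nor the integrals.
  have hdens : HasDensity Ω μ (hρ.1.mk ρ) := by
    refine ⟨hρ.1.measurable_mk.aemeasurable, hρ.2.trans (withDensity_congr_ae ?_)⟩
    filter_upwards [hρ.1.ae_eq_mk] with x hx
    rw [← hx]
  obtain ⟨w, hw, hwl⟩ := exists_inner_eq_of_le_norm T l
    (ENNReal.toReal_nonneg (a := energySlope Ω α lam μ)) fun ξ => by
      have h := integral_rpow_mul_trace_le hΩ.measurableSet hΩb hα hlam ξ.2.1 ξ.2.2.1 ξ.2.2.2 hμ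
        hρ.1.measurable_mk hdens hE hslope
      have h2 : ‖T ξ‖ = (eLpNorm ξ.1 2 μ).toReal := Lp.norm_toLp _ (hLp ξ)
      rw [h2]
      refine le_trans (le_of_eq (integral_congr_ae ?_)) h
      filter_upwards [hρ.1.ae_eq_mk] with x hx
      rw [← hx]
  refine ⟨w, hw, fun ξ hξ => (hwl ⟨ξ, hξ⟩).trans ?_⟩
  rw [L2.inner_def]
  refine integral_congr_ae ?_
  filter_upwards [(hLp ⟨ξ, hξ⟩).coeFn_toLp] with x hx
  exact congrArg _ hx

/-- The field `φ eᵢ` has divergence `∂ᵢ φ`, so testing with it gives the `i`-th component of `∇ρ^α =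
-ρ w`. -/
theorem hasWeakGradient_of_velocity (hρ : HasDensity Ω μ ρ)
    {w : EuclideanSpace ℝ (Fin d) → EuclideanSpace ℝ (Fin d)}
    (hIα : IntegrableOn (fun x => (ρ x : ℝ) ^ α) Ω)
    (hIw : IntegrableOn (fun x => (ρ x : ℝ) • w x) Ω)
    (hw : ∀ ξ ∈ testFields Ω, ∫ x in Ω, (ρ x : ℝ) ^ α * traceCLM _ (fderiv ℝ ξ x)
        = ∫ x, inner ℝ (w x) (ξ x) ∂μ) :
    HasWeakGradient Ω (fun x => (ρ x : ℝ) ^ α) fun x => -((ρ x : ℝ) • w x) := by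
  refine ⟨hIα.locallyIntegrableOn, hIw.neg.locallyIntegrableOn, fun φ hφ hφc hφΩ i => ?_⟩
  have hξ : (fun x => φ x • EuclideanSpace.single i (1 : ℝ)) ∈ testFields Ω :=
    ⟨hφ.smul contDiff_const, hφc.smul_right,
      (tsupport_smul_subset_left φ fun _ => EuclideanSpace.single i (1 : ℝ)).trans hφΩ⟩
  have h := hw _ hξ
  have hfd : ∀ x, fderiv ℝ (fun x => φ x • EuclideanSpace.single i (1 : ℝ)) x
      = (fderiv ℝ φ x).smulRight (EuclideanSpace.single i 1) := fun x =>
    fderiv_smul_const (hφ.differentiable (by simp) x) _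
  simp_rw [hfd, traceCLM_smulRight] at h
  rw [h, hρ.2, integral_withDensity_eq_integral_smul₀ hρ.1, ← integral_neg]
  refine integral_congr_ae (Eventually.of_forall fun x => ?_)
  simp only [inner_smul_right, EuclideanSpace.inner_single_right, NNReal.smul_def, smul_eq_mul,
    PiLp.neg_apply, PiLp.smul_apply, conj_trivial]
  ring

end WeakGradient

end PMEDirichlet

/-! ### Conclusion -/

theorem lemma3p3 {d : ℕ} (Ω : Set (EuclideanSpace ℝ (Fin d)))
    (hΩo : IsOpen Ω) (hΩc : IsConnected Ω) (hΩb : Bornology.IsBounded Ω)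
    (α lam : ℝ) (hα : 1 < α) (hlam : 0 ≤ lam)
    (μ : Measure (EuclideanSpace ℝ (Fin d))) (hμ : μ ∈ PMEDirichlet.M2 Ω)
    (ρ : EuclideanSpace ℝ (Fin d) → ℝ≥0) (hρ : PMEDirichlet.HasDensity Ω μ ρ)
    (hE : PMEDirichlet.energy Ω α lam μ < ⊤)
    (hslope : PMEDirichlet.energySlope Ω α lam μ < ⊤) :
    PMEDirichlet.MemW11 Ω (fun x => (ρ x : ℝ) ^ α) ∧
      ∀ g : EuclideanSpace ℝ (Fin d) → EuclideanSpace ℝ (Fin d),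
        PMEDirichlet.HasWeakGradient Ω (fun x => (ρ x : ℝ) ^ α) g →
          ∫⁻ x in Ω, ‖g x‖ₑ ^ 2 / (ρ x : ℝ≥0∞) ≤ PMEDirichlet.energySlope Ω α lam μ ^ 2 := by
  have hfinμ := PMEDirichlet.isFiniteMeasure_of_energy hΩb hα hlam hρ hE
  have hIα := PMEDirichlet.integrableOn_rpow hΩb hα hlam hρ hE
  obtain ⟨w, hwn, hw⟩ := PMEDirichlet.exists_velocity hΩo hΩb hα hlam hμ hρ hE hslope
  -- Since `μ` is finite, `w` in `L²(μ)` is also in `L¹(μ)`, which means that `ρ w` is Lebesgue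
  -- integrable on `Ω`.
  have hIw : IntegrableOn (fun x => (ρ x : ℝ) • w x) Ω := by
    refine (integrable_withDensity_iff_integrable_coe_smul₀ hρ.1).1 ?_
    rw [← hρ.2]
    exact (Lp.memLp w).integrable (by norm_num)
  have hgrad := PMEDirichlet.hasWeakGradient_of_velocity hρ hIα hIw hw
  refine ⟨⟨hIα, _, hgrad, hIw.neg⟩, fun g hg => ?_⟩
  have hwsq : ∫⁻ x, ‖w x‖ₑ ^ 2 ∂μ = ENNReal.ofReal ‖w‖ ^ 2 := by
    rw [Lp.norm_def, ENNReal.ofReal_toReal (Lp.eLpNorm_ne_top w),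
      eLpNorm_eq_lintegral_rpow_enorm_toReal two_ne_zero ENNReal.ofNat_ne_top,
      ← ENNReal.rpow_natCast, ← ENNReal.rpow_mul]
    simp
  calc ∫⁻ x in Ω, ‖g x‖ₑ ^ 2 / (ρ x : ℝ≥0∞)
      ≤ ∫⁻ x in Ω, (ρ x : ℝ≥0∞) * ‖w x‖ₑ ^ 2 := by
        refine lintegral_mono_ae ?_
        filter_upwards [hg.ae_eq hΩo hgrad] with x hx
        rw [hx, enorm_neg, enorm_smul, Real.enorm_of_nonneg (ρ x).coe_nonneg,
          ENNReal.ofReal_coe_nnreal, mul_pow]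
        -- Passing to the product form also covers `ρ x = 0`: there the numerator vanishes as well,
        -- and `0 / 0 = 0`.
        refine ENNReal.div_le_of_le_mul ?_
        rw [pow_two (ρ x : ℝ≥0∞), mul_right_comm]
    _ = ∫⁻ x, ‖w x‖ₑ ^ 2 ∂μ := by
        have h2 := lintegral_withDensity_eq_lintegral_mul_non_measurable₀ (volume.restrict Ω)
          hρ.1.coe_nnreal_ennreal (Eventually.of_forall fun x => ENNReal.coe_lt_top)
          fun x => ‖w x‖ₑ ^ 2
        rw [← hρ.2] at h2
        exact h2.symm
    _ ≤ PMEDirichlet.energySlope Ω α lam μ ^ 2 := by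
        rw [hwsq]
        gcongr
        exact ENNReal.ofReal_le_of_le_toReal hwn
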